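/- Let $R$ be a commutative local ring, not necessarily Noetherian, with maximal ideal $M$ and residue field $k=R/M$. Assume that $R$ is complete with respect to the $M$-adic topology, i.e. $R$ is Hausdorff in this topology and every Cauchy sequence converges; equivalently, the natural map $R\to\varprojlim_{n\ge 1}R/M^{n}$ is an isomorphism. Let $\pi:R\to k$ be the natural surjective ring map. (1) There is a ring homomorphism $s:k\to R$ with $\pi\circ s=\mathrm{id}_k$ if and only if $\operatorname{char}(R)=\operatorname{char}(k)$. (2) If $\operatorname{char}(R)\neq\operatorname{char}(k)$, then there is a group homomorphism $\sigma:k^{*}\to R^{*}$ with $\pi^{*}\circ\sigma=\mathrm{id}_{k^{*}}$, where $\pi^{*}:R^{*}\to k^{*}$ is the surjective homomorphism of unit groups induced by $\pi$. -/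

import Mathlib

/-!
Every field extension of a perfect field is formally smooth: its first cotangent homology commutes
with the filtered union of the finitely generated subextensions, which are separably generated.
If `char R = char k`, then `R` contains the prime field of `k`, which is perfect, so the identity of
`k = R / M` lifts successively to all `R / Mⁿ`, hence to the complete ring `R`.

If `char k = p > 0`, the kernel of `(R / Mⁿ⁺¹)ˣ → (R / Mⁿ)ˣ` is killed by `p`, whereas `kˣ` has no
`p`-torsion. An extension of a group without `p`-torsion by a group killed by `p` splits, so the
identity of `kˣ` also lifts successively to all `(R / Mⁿ)ˣ`.
-/

open IsLocalRing

section FormallySmooth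

open MvPolynomial

lemma subsingleton_h1Cotangent_iff_forall_pderiv {R S ι : Type*} [CommRing R] [CommRing S]
    [Algebra R S] (P : Algebra.Generators R S ι) :
    Subsingleton (Algebra.H1Cotangent R S) ↔
      ∀ f ∈ P.ker, (∀ i, aeval P.val (pderiv i f) = 0) → f ∈ P.ker ^ 2 := by
  have cotangentComplex_eq_zero_iff (f : P.toExtension.ker) :
      P.toExtension.cotangentComplex (.mk f) = 0 ↔ ∀ i, aeval P.val (pderiv i f.1) = 0 := by
    rw [← P.cotangentSpaceBasis.repr.map_eq_zero_iff, Finsupp.ext_iff,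
      Algebra.Extension.cotangentComplex_mk]
    exact forall_congr' fun i ↦ Eq.congr (P.cotangentSpaceBasis_repr_one_tmul f.1 i) rfl
  rw [← P.equivH1Cotangent.toEquiv.subsingleton_congr,
    Algebra.Extension.subsingleton_h1Cotangent, injective_iff_map_eq_zero,
    Algebra.Extension.Cotangent.mk_surjective.forall, Subtype.forall]
  refine forall₂_congr fun f hf ↦ ?_
  rw [cotangentComplex_eq_zero_iff, Algebra.Extension.Cotangent.mk_eq_zero_iff]
  rfl

/-- A polynomial in the elements of `S` involves only finitely many of them, so it is a polynomial
over one of the subalgebras, where the Jacobian criterion applies to it. -/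
lemma subsingleton_h1Cotangent_of_forall_finset {R S : Type*} [CommRing R] [CommRing S]
    [Algebra R S]
    (h : ∀ s : Finset S, ∃ T : Subalgebra R S, ↑s ⊆ (T : Set S) ∧
      Subsingleton (Algebra.H1Cotangent R T)) :
    Subsingleton (Algebra.H1Cotangent R S) := by
  rw [subsingleton_h1Cotangent_iff_forall_pderiv (Algebra.Generators.self R S)]
  intro f hf hdf
  obtain ⟨T, hsT, hT⟩ := h f.vars
  obtain ⟨g, rfl⟩ := exists_rename_eq_of_vars_subset_range f (Subtype.val : T → S)
    Subtype.val_injective fun x hx ↦ ⟨⟨x, hsT hx⟩, rfl⟩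
  have aeval_rename_val (q : MvPolynomial T R) :
      aeval (id : S → S) (rename Subtype.val q) = (aeval (id : T → T) q : S) := by
    rw [aeval_rename]
    exact (comp_aeval_apply (id : T → T) T.val q).symm
  have rename_mem_ker_iff (q : MvPolynomial T R) :
      rename Subtype.val q ∈ (Algebra.Generators.self R S).ker ↔
        q ∈ (Algebra.Generators.self R T).ker := by
    change aeval (id : S → S) _ = 0 ↔ aeval (id : T → T) q = 0
    rw [aeval_rename_val, ZeroMemClass.coe_eq_zero]
  have hg : g ∈ (Algebra.Generators.self R T).ker ^ 2 := by
    refine (subsingleton_h1Cotangent_iff_forall_pderiv (Algebra.Generators.self R T)).mp hT g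
      ((rename_mem_ker_iff g).mp hf) fun i ↦ ?_
    have hdi : aeval (id : S → S) (pderiv i.1 (rename Subtype.val g)) = 0 := hdf i
    rwa [pderiv_rename Subtype.val_injective, aeval_rename_val, ZeroMemClass.coe_eq_zero] at hdi
  have ker_le : (Algebra.Generators.self R T).ker ≤
      (Algebra.Generators.self R S).ker.comap (rename Subtype.val) :=
    fun q hq ↦ (rename_mem_ker_iff q).mpr hq
  exact Ideal.le_comap_pow _ _ (Ideal.pow_right_mono ker_le 2 hg)

theorem formallySmooth_of_perfectField (K L : Type*) [Field K] [PerfectField K] [Field L]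
    [Algebra K L] : Algebra.FormallySmooth K L := by
  refine ⟨inferInstance, subsingleton_h1Cotangent_of_forall_finset fun s ↦ ?_⟩
  let E := IntermediateField.adjoin K (s : Set L)
  have : Algebra.EssFiniteType K E :=
    IntermediateField.essFiniteType_iff.mpr (IntermediateField.fg_adjoin_finset s)
  exact ⟨E.toSubalgebra, IntermediateField.subset_adjoin K _,
    inferInstanceAs (Subsingleton (Algebra.H1Cotangent K E))⟩

end FormallySmooth

section CoefficientField

lemma ringChar_dvd_of_ringHom {R S : Type*} [NonAssocSemiring R] [NonAssocSemiring S]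
    (f : R →+* S) : ringChar S ∣ ringChar R :=
  ringChar.dvd (by rw [← map_natCast f, ringChar.Nat.cast_ringChar, map_zero])

lemma nonempty_algebra_rat_of_charZero_residueField (R : Type*) [CommRing R] [IsLocalRing R]
    [CharZero (ResidueField R)] : Nonempty (Algebra ℚ R) :=
  (EqualCharZero.nonempty_algebraRat_iff R).mpr fun _ hI ↦
    RingHom.charZero (S := ResidueField R) (Ideal.Quotient.factor (le_maximalIdeal hI))

variable (R : Type*) [CommRing R] [IsLocalRing R] [IsAdicComplete (maximalIdeal R) R]

theorem exists_algHom_residue_comp_eq_id (K : Type*) [Field K] [PerfectField K] [Algebra K R] :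
    ∃ s : ResidueField R →ₐ[K] R,
      (residue R).comp (s : ResidueField R →+* R) = RingHom.id (ResidueField R) := by
  have := formallySmooth_of_perfectField K (ResidueField R)
  obtain ⟨s, hs⟩ := Algebra.FormallySmooth.exists_mkₐ_comp_eq_of_isAdicComplete
    (I := maximalIdeal R) (AlgHom.id K (ResidueField R))
  exact ⟨s, RingHom.ext fun x ↦ congr($hs x)⟩

theorem exists_residue_comp_eq_id_of_charZero [CharZero (ResidueField R)] :
    ∃ s : ResidueField R →+* R, (residue R).comp s = RingHom.id (ResidueField R) := by
  obtain ⟨_⟩ := nonempty_algebra_rat_of_charZero_residueField R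
  obtain ⟨s, hs⟩ := exists_algHom_residue_comp_eq_id R ℚ
  exact ⟨s, hs⟩

theorem exists_residue_comp_eq_id_of_charP (p : ℕ) [Fact p.Prime] [CharP R p] :
    ∃ s : ResidueField R →+* R, (residue R).comp s = RingHom.id (ResidueField R) := by
  let := ZMod.algebra R p
  obtain ⟨s, hs⟩ := exists_algHom_residue_comp_eq_id R (ZMod p)
  exact ⟨s, hs⟩

theorem exists_residue_comp_eq_id_of_ringChar_eq (h : ringChar R = ringChar (ResidueField R)) :
    ∃ s : ResidueField R →+* R, (residue R).comp s = RingHom.id (ResidueField R) := by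
  obtain _ | ⟨p, _, _⟩ := CharP.exists' (ResidueField R)
  · exact exists_residue_comp_eq_id_of_charZero R
  · have : CharP R p := ringChar.of_eq (h.trans (ringChar.eq _ p))
    exact exists_residue_comp_eq_id_of_charP R p

end CoefficientField

section PrimeTorsion

variable (p : ℕ) [Fact p.Prime]

lemma exists_comp_eq_id_of_injective_of_nsmul_eq_zero {V W : Type*} [AddCommGroup V]
    [AddCommGroup W] (hV : ∀ x : V, p • x = 0) (hW : ∀ x : W, p • x = 0) (j : V →+ W)
    (hj : Function.Injective j) : ∃ r : W →+ V, r.comp j = AddMonoidHom.id V := by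
  let : Module (ZMod p) V := AddCommGroup.zmodModule hV
  let : Module (ZMod p) W := AddCommGroup.zmodModule hW
  obtain ⟨r, hr⟩ := (j.toZModLinearMap p).exists_leftInverse_of_injective
    (LinearMap.ker_eq_bot.mpr hj)
  exact ⟨r.toAddMonoidHom, AddMonoidHom.ext fun x ↦ LinearMap.congr_fun hr x⟩

/-- As `A` has no `p`-torsion, `f.ker` injects into the `𝔽_p`-vector space `E / pE`. -/
lemma exists_comp_subtype_ker_eq_id {E A : Type*} [AddCommGroup E] [AddCommGroup A] (f : E →+ A)
    (hker : ∀ x ∈ f.ker, p • x = 0) (hA : ∀ a : A, p • a = 0 → a = 0) :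
    ∃ r : E →+ f.ker, r.comp f.ker.subtype = AddMonoidHom.id f.ker := by
  let pE : AddSubgroup E := (nsmulAddMonoidHom p : E →+ E).range
  have nsmul_quotient (x : E ⧸ pE) : p • x = 0 := by
    obtain ⟨e, rfl⟩ := QuotientAddGroup.mk_surjective x
    exact (QuotientAddGroup.eq_zero_iff (p • e)).mpr ⟨e, rfl⟩
  let j : f.ker →+ E ⧸ pE := (QuotientAddGroup.mk' pE).comp f.ker.subtype
  have hj : Function.Injective j := by
    rw [injective_iff_map_eq_zero]
    rintro ⟨x, hx⟩ hjx
    obtain ⟨e, rfl⟩ := (QuotientAddGroup.eq_zero_iff x).mp hjx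
    have he : e ∈ f.ker := hA _ ((map_nsmul f p e).symm.trans hx)
    exact Subtype.ext (hker e he)
  obtain ⟨r, hr⟩ := exists_comp_eq_id_of_injective_of_nsmul_eq_zero p
    (fun x ↦ Subtype.ext (hker x.1 x.2)) nsmul_quotient j hj
  exact ⟨r.comp (QuotientAddGroup.mk' pE), hr⟩

lemma exists_comp_eq_id_of_surjective_of_nsmul_ker {E A : Type*} [AddCommGroup E]
    [AddCommGroup A] (f : E →+ A) (hf : Function.Surjective f) (hker : ∀ x ∈ f.ker, p • x = 0)
    (hA : ∀ a : A, p • a = 0 → a = 0) : ∃ s : A →+ E, f.comp s = AddMonoidHom.id A := by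
  obtain ⟨r, hr⟩ := exists_comp_subtype_ker_eq_id p f hker hA
  have exact_ker : Function.Exact f.ker.subtype.toIntLinearMap f.toIntLinearMap := fun x ↦
    ⟨fun hx ↦ ⟨⟨x, hx⟩, rfl⟩, fun ⟨y, hy⟩ ↦ hy ▸ y.2⟩
  obtain ⟨s, hs⟩ := ((exact_ker.split_tfae Subtype.val_injective hf).out 0 1 rfl rfl).mpr
    ⟨r.toIntLinearMap, LinearMap.ext fun x ↦ congr($hr x)⟩
  exact ⟨s.toAddMonoidHom, AddMonoidHom.ext fun a ↦ congr($hs a)⟩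

/-- The lifts of `σ` along `q` are the sections of the pullback of `q` along `σ`. -/
theorem exists_comp_eq_of_surjective_of_pow_ker {A G H : Type*} [CommGroup A] [CommGroup G]
    [CommGroup H] (q : G →* H) (hq : Function.Surjective q) (hker : ∀ x ∈ q.ker, x ^ p = 1)
    (hA : ∀ a : A, a ^ p = 1 → a = 1) (σ : A →* H) : ∃ τ : A →* G, q.comp τ = σ := by
  let E : Subgroup (G × A) :=
    (q.comp (MonoidHom.fst G A)).eqLocus (σ.comp (MonoidHom.snd G A))
  let f : E →* A := (MonoidHom.snd G A).comp E.subtype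
  have hf : Function.Surjective f := fun a ↦
    let ⟨g, hg⟩ := hq (σ a)
    ⟨⟨(g, a), hg⟩, rfl⟩
  have hker_f : ∀ x ∈ f.ker, x ^ p = 1 := by
    rintro ⟨⟨g, a⟩, hga⟩ (rfl : a = 1)
    have hg : g ∈ q.ker := Eq.trans hga (map_one σ)
    exact Subtype.ext (Prod.ext (hker g hg) (one_pow p))
  obtain ⟨s, hs⟩ := exists_comp_eq_id_of_surjective_of_nsmul_ker p f.toAdditive hf hker_f hA
  let s' : A →* E := MonoidHom.toAdditive.symm s
  refine ⟨(MonoidHom.fst G A).comp (E.subtype.comp s'), MonoidHom.ext fun a ↦ ?_⟩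
  calc q (s' a).1.1 = σ (s' a).1.2 := (s' a).2
    _ = σ a := congrArg σ congr($hs a)

end PrimeTorsion

section Units

variable {R : Type*} [CommRing R] (I : Ideal R)

lemma units_map_factorPowSucc_surjective {n : ℕ} (hn : 0 < n) :
    Function.Surjective
      (Units.map (Ideal.Quotient.factorPowSucc I n : R ⧸ I ^ (n + 1) →* R ⧸ I ^ n)) := by
  have : IsLocalHom (Ideal.Quotient.factorPowSucc I n) :=
    ⟨fun _ ↦ factorPowSucc.isUnit_of_isUnit_image hn⟩
  exact surjective_units_map_of_local_ringHom _ (Ideal.Quotient.factor_surjective _) this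

variable {I}

lemma pow_sub_pow_mem_pow_succ {p n : ℕ} (hp : (p : R) ∈ I) (hn : n ≠ 0) {a b : R}
    (hab : a - b ∈ I ^ n) : a ^ p - b ^ p ∈ I ^ (n + 1) := by
  have geom_sum_mem : ∑ i ∈ Finset.range p, a ^ i * b ^ (p - 1 - i) ∈ I := by
    have hmk : Ideal.Quotient.mk I a = Ideal.Quotient.mk I b :=
      Ideal.Quotient.eq.mpr (Ideal.pow_le_self hn hab)
    rw [← Ideal.Quotient.eq_zero_iff_mem] at hp ⊢
    simp only [map_sum, map_mul, map_pow, hmk, geom_sum₂_self, ← map_natCast (Ideal.Quotient.mk I),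
      hp, zero_mul]
  rw [← (Commute.all a b).geom_sum₂_mul, pow_succ']
  exact Ideal.mul_mem_mul geom_sum_mem hab

lemma pow_eq_one_of_mem_ker_units_map_factorPowSucc {p n : ℕ} (hp : (p : R) ∈ I) (hn : n ≠ 0)
    (u : (R ⧸ I ^ (n + 1))ˣ)
    (hu : u ∈ (Units.map (Ideal.Quotient.factorPowSucc I n : R ⧸ I ^ (n + 1) →* R ⧸ I ^ n)).ker) :
    u ^ p = 1 := by
  obtain ⟨a, ha⟩ := Ideal.Quotient.mk_surjective u.1
  have ha_sub : a - 1 ∈ I ^ n := by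
    rw [← Ideal.Quotient.eq, map_one]
    simpa [← ha] using congr(($hu).1)
  have hpow := Ideal.Quotient.eq.mpr (pow_sub_pow_mem_pow_succ hp hn ha_sub)
  exact Units.ext (by simpa [ha] using hpow)

variable (I)

/-- A monoid homomorphism into a ring is a ring homomorphism out of the monoid ring, and those lift
to adically complete rings. -/
lemma exists_monoidHom_forall_mk_eq [IsAdicComplete I R] {G : Type*} [Monoid G] {a : ℕ → ℕ}
    (ha : StrictMono a) (f : (n : ℕ) → G →* R ⧸ I ^ a n)
    (hf : ∀ n x, Ideal.Quotient.factorPow I (ha.monotone n.le_succ) (f (n + 1) x) = f n x) :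
    ∃ F : G →* R, ∀ n x, Ideal.Quotient.mk (I ^ a n) (F x) = f n x := by
  let g (n : ℕ) : MonoidAlgebra ℤ G →+* R ⧸ I ^ a n :=
    (MonoidAlgebra.lift ℤ (R ⧸ I ^ a n) G (f n)).toRingHom
  have g_of (n : ℕ) (x : G) : g n (MonoidAlgebra.of ℤ G x) = f n x :=
    MonoidAlgebra.lift_of (f n) x
  have factor_comp_g {n : ℕ} :
      (Ideal.Quotient.factorPow I (ha.monotone n.le_succ)).comp (g (n + 1)) = g n := by
    refine MonoidAlgebra.ringHom_ext' (Subsingleton.elim _ _) (MonoidHom.ext fun x ↦ ?_)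
    exact (congrArg _ (g_of (n + 1) x)).trans ((hf n x).trans (g_of n x).symm)
  refine ⟨(IsAdicComplete.StrictMono.liftRingHom I ha g factor_comp_g : _ →* R).comp
    (MonoidAlgebra.of ℤ G), fun n x ↦ ?_⟩
  exact (IsAdicComplete.StrictMono.mk_liftRingHom I ha g factor_comp_g _).trans (g_of n x)

theorem exists_units_map_mk_comp_eq [IsAdicComplete I R] (p : ℕ) [Fact p.Prime]
    (hp : (p : R) ∈ I) {A : Type*} [CommGroup A] (hA : ∀ a : A, a ^ p = 1 → a = 1)
    (σ : A →* (R ⧸ I)ˣ) :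
    ∃ τ : A →* Rˣ, (Units.map (Ideal.Quotient.mk I : R →* R ⧸ I)).comp τ = σ := by
  have exists_lift (n : ℕ) (ρ : A →* (R ⧸ I ^ (n + 1))ˣ) :
      ∃ τ : A →* (R ⧸ I ^ (n + 1 + 1))ˣ,
        (Units.map (Ideal.Quotient.factorPowSucc I (n + 1) :
          R ⧸ I ^ (n + 1 + 1) →* R ⧸ I ^ (n + 1))).comp τ = ρ :=
    exists_comp_eq_of_surjective_of_pow_ker p _
      (units_map_factorPowSucc_surjective I n.succ_pos)
      (pow_eq_one_of_mem_ker_units_map_factorPowSucc hp n.succ_ne_zero) hA ρ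
  choose next hnext using exists_lift
  let e : R ⧸ I ^ (0 + 1) ≃+* R ⧸ I := Ideal.quotEquivOfEq (pow_one I)
  let ρ (n : ℕ) : A →* (R ⧸ I ^ (n + 1))ˣ :=
    Nat.rec ((Units.map (e.symm : R ⧸ I →* R ⧸ I ^ (0 + 1))).comp σ) next n
  obtain ⟨F, hF⟩ := exists_monoidHom_forall_mk_eq I (strictMono_id.add_const 1)
    (fun n ↦ (Units.coeHom _).comp (ρ n)) fun n x ↦ congr(($(hnext n (ρ n)) x).1)
  refine ⟨F.toHomUnits, MonoidHom.ext fun x ↦ Units.ext ?_⟩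
  calc Ideal.Quotient.mk I (F x) = e (Ideal.Quotient.mk (I ^ (0 + 1)) (F x)) := rfl
    _ = e (e.symm (σ x)) := congrArg e (hF 0 x)
    _ = σ x := e.apply_symm_apply _

end Units

lemma units_eq_one_of_pow_expChar_eq_one (k : Type*) [CommRing k] [IsReduced k] (p : ℕ)
    [ExpChar k p] (a : kˣ) (ha : a ^ p = 1) : a = 1 :=
  Units.ext (frobenius_inj k p (by simpa [frobenius_def] using congr(($ha).1)))

theorem exists_units_map_residue_comp_eq_id (R : Type*) [CommRing R] [IsLocalRing R]
    [IsAdicComplete (maximalIdeal R) R] :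
    ∃ σ : (ResidueField R)ˣ →* Rˣ,
      (Units.map (residue R : R →* ResidueField R)).comp σ = MonoidHom.id (ResidueField R)ˣ := by
  obtain _ | ⟨p, _, _⟩ := CharP.exists' (ResidueField R)
  · obtain ⟨s, hs⟩ := exists_residue_comp_eq_id_of_charZero R
    exact ⟨Units.map s, MonoidHom.ext fun x ↦ Units.ext congr($hs x)⟩
  · have hp : (p : R) ∈ maximalIdeal R := by
      rw [← residue_eq_zero_iff, map_natCast, CharP.cast_eq_zero]
    exact exists_units_map_mk_comp_eq (maximalIdeal R) p hp
      (units_eq_one_of_pow_expChar_eq_one (ResidueField R) p) (MonoidHom.id _)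

theorem theorem2_general (R : Type*) [CommRing R] [IsLocalRing R]
    [IsAdicComplete (maximalIdeal R) R] :
    ((∃ s : ResidueField R →+* R, (residue R).comp s = RingHom.id (ResidueField R)) ↔
      ringChar R = ringChar (ResidueField R)) ∧
    ∃ σ : (ResidueField R)ˣ →* Rˣ,
      (Units.map (residue R : R →* ResidueField R)).comp σ = MonoidHom.id (ResidueField R)ˣ := by
  refine ⟨⟨fun ⟨s, _⟩ ↦ ?_, exists_residue_comp_eq_id_of_ringChar_eq R⟩,
    exists_units_map_residue_comp_eq_id R⟩
  exact Nat.dvd_antisymm (ringChar_dvd_of_ringHom s) (ringChar_dvd_of_ringHom (residue R))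

theorem theorem2 (R : Type*) [CommRing R] [IsLocalRing R]
    [IsAdicComplete (IsLocalRing.maximalIdeal R) R] :
    ((∃ s : IsLocalRing.ResidueField R →+* R,
        (IsLocalRing.residue R).comp s = RingHom.id (IsLocalRing.ResidueField R)) ↔
      ringChar R = ringChar (IsLocalRing.ResidueField R)) ∧
    (ringChar R ≠ ringChar (IsLocalRing.ResidueField R) →
      ∃ σ : (IsLocalRing.ResidueField R)ˣ →* Rˣ,
        (Units.map (IsLocalRing.residue R : R →* IsLocalRing.ResidueField R)).comp σ =
          MonoidHom.id (IsLocalRing.ResidueField R)ˣ) :=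
  (theorem2_general R).imp_right fun h _ ↦ h
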